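/- Let $\mathcal{M}_2$ be the algebra of complex $2\times 2$ matrices and let $\mathcal{S}$ be the convex set of stochastic maps on $\mathcal{M}_2$, that is, of linear maps $\Phi:\mathcal{M}_2\to\mathcal{M}_2$ that are completely positive and trace-preserving. Then every $\Phi\in\mathcal{S}$ can be written as a convex combination of two maps in the closure of the set of extreme points of $\mathcal{S}$; in fact the convex combination can be chosen to be a midpoint: there are $\Phi_1,\Phi_2$ in the closure of the set of extreme points of $\mathcal{S}$ (closure in the finite-dimensional space of linear maps on $\mathcal{M}_2$) with $$\Phi=\tfrac12\,\Phi_1+\tfrac12\,\Phi_2 .$$ -/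

import Mathlib

open scoped Matrix.Norms.L2Operator MatrixOrder ComplexOrder CStarAlgebra

/-- The algebra of complex `2 × 2` matrices, as a C⋆-algebra: operator norm on `ℂ²`, and the
usual (Loewner) order. -/
abbrev M2 : Type := Matrix (Fin 2) (Fin 2) ℂ

/-- `Φ` is completely positive: applying `Φ` to all entries of a positive `k × k` matrix over `M2`
gives a positive matrix, for every `k`. -/
def IsCompletelyPositive (Φ : M2 →L[ℂ] M2) : Prop :=
  ∃ φ : M2 →CP M2, φ.toLinearMap = (Φ : M2 →ₗ[ℂ] M2)

/-- `Φ` preserves the trace. -/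
def IsTracePreserving (Φ : M2 →L[ℂ] M2) : Prop :=
  ∀ X : M2, (Φ X).trace = X.trace

/-- The convex set of stochastic maps: the completely positive, trace-preserving linear maps on
`M2`. Every linear map on `M2` is continuous because `M2` is finite-dimensional, so the ambient
space `M2 →L[ℂ] M2` contains all linear maps, and its norm topology is the usual topology. -/
def stochasticMaps : Set (M2 →L[ℂ] M2) :=
  {Φ | IsCompletelyPositive Φ ∧ IsTracePreserving Φ}

/-- The generalized extreme points: the closure of the set of extreme points of the set of
stochastic maps. -/
def generalizedExtremePoints : Set (M2 →L[ℂ] M2) :=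
  closure (Set.extremePoints ℝ stochasticMaps)

/-! Group the Choi matrix of a stochastic map by output index: its blocks are A, C, C*, 1 − A. When
A and 1 − A are positive definite, write A = S*S and 1 − A = T*T; by the Schur complement,
positivity says that C = S*RT with R a contraction. An invertible R is a midpoint of two unitaries
(`exists_unitary_midpoint`), so the map is a midpoint of two maps whose Schur complement vanishes.
Such maps are extreme when tr A ≠ 1 (`ofBlocks_mem_extremePoints`): their Choi kernel is so large
that a summand is determined by its corner, and trace preservation then fixes the corner.

Every stochastic map is a limit of maps satisfying these generic conditions, and midpoints of the
compact set of generalized extreme points form a closed set. -/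

open Matrix

/-! ### Two facts about matrices. -/

/-- An invertible contraction is the midpoint of two unitary matrices. -/
theorem exists_unitary_midpoint {n : Type*} [Fintype n] [DecidableEq n] (R : Matrix n n ℂ)
    (hR : IsUnit R) (h : (1 - Rᴴ * R).PosSemidef) :
    ∃ U V : Matrix n n ℂ, Uᴴ * U = 1 ∧ Vᴴ * V = 1 ∧ R = (1 / 2 : ℝ) • U + (1 / 2 : ℝ) • V := by
  -- Polar decomposition R = WP; the positive contraction P is the mean of the unitary P + i√(1 −
  -- P²) and its adjoint.
  set P : Matrix n n ℂ := CFC.sqrt (star R * R) with hP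
  have hPP : P * P = star R * R := CFC.sqrt_mul_sqrt_self _ (star_mul_self_nonneg R)
  have hP0 : 0 ≤ P := CFC.sqrt_nonneg _
  have hPs : star P = P := (IsSelfAdjoint.of_nonneg hP0).star_eq
  have hnorm : ‖P‖ ≤ 1 := by
    have h1 : P ^ 2 ≤ 1 := by
      rw [sq, hPP, ← sub_nonneg]
      exact h.nonneg
    have h2 : ‖P ^ 2‖ ≤ 1 :=
      (CStarAlgebra.norm_le_one_iff_of_nonneg (P ^ 2)
        ((IsSelfAdjoint.of_nonneg hP0).sq_nonneg)).2 h1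
    rw [sq, (IsSelfAdjoint.of_nonneg hP0).norm_mul_self] at h2
    exact (sq_le_one_iff₀ (norm_nonneg _)).1 h2
  have hPu : IsUnit P := by
    have : IsUnit (P * P) := hPP ▸ (hR.star.mul hR)
    exact isUnit_of_mul_isUnit_left this
  have hdet : IsUnit P.det := (Matrix.isUnit_iff_isUnit_det P).1 hPu
  set W : Matrix n n ℂ := R * P⁻¹ with hW
  have hWP : W * P = R := by rw [hW, Matrix.mul_assoc, Matrix.nonsing_inv_mul _ hdet, mul_one]
  have hPi : star (P⁻¹) = P⁻¹ := by
    rw [star_eq_conjTranspose, conjTranspose_nonsing_inv, ← star_eq_conjTranspose, hPs]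
  have hWW : star W * W = 1 := by
    rw [hW, star_mul, hPi]
    calc P⁻¹ * star R * (R * P⁻¹) = P⁻¹ * (star R * R) * P⁻¹ := by simp only [Matrix.mul_assoc]
      _ = 1 := by
        rw [← hPP, ← Matrix.mul_assoc, Matrix.nonsing_inv_mul _ hdet, Matrix.one_mul,
          Matrix.mul_nonsing_inv _ hdet]
  let a : selfAdjoint (Matrix n n ℂ) := ⟨P, IsSelfAdjoint.of_nonneg hP0⟩
  let u : unitary (Matrix n n ℂ) := selfAdjoint.unitarySelfAddISMul a hnorm
  have hu : (u : Matrix n n ℂ) = P + Complex.I • CFC.sqrt (1 - P ^ 2) := rfl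
  have hu' : (star (u : Matrix n n ℂ)) = P - Complex.I • CFC.sqrt (1 - P ^ 2) :=
    selfAdjoint.star_coe_unitarySelfAddISMul a hnorm
  refine ⟨W * u, W * star u, ?_, ?_, ?_⟩
  · change star (W * (u : Matrix n n ℂ)) * (W * u) = 1
    rw [star_mul, Matrix.mul_assoc, ← Matrix.mul_assoc (star W), hWW, Matrix.one_mul]
    exact u.2.1
  · change star (W * star (u : Matrix n n ℂ)) * (W * star (u : Matrix n n ℂ)) = 1
    rw [star_mul, Matrix.mul_assoc, ← Matrix.mul_assoc (star W), hWW, Matrix.one_mul, star_star]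
    exact u.2.2
  · rw [← smul_add, ← Matrix.mul_add, Unitary.coe_star, hu', hu, add_add_sub_cancel, ← two_smul ℝ,
      Matrix.mul_smul, hWP, smul_smul]
    norm_num

/-- A Hermitian `2 × 2` matrix `H` with `H + Nᴴ H N = 0` vanishes unless `|det N| = 1`. -/
theorem eq_zero_of_add_conjTranspose_mul_mul_eq_zero (H N : M2) (hH : H.IsHermitian)
    (h : H + Nᴴ * H * N = 0) (hN : star N.det * N.det ≠ 1) : H = 0 := by
  have hdet : H.det = 0 := by
    have h1 : H = -(Nᴴ * H * N) := eq_neg_of_add_eq_zero_left h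
    -- The sign disappears because the size is even.
    have h2 : H.det = star N.det * N.det * H.det := by
      conv_lhs => rw [h1]
      rw [det_neg, det_mul, det_mul, det_conjTranspose]
      simp
      ring
    have h3 : (1 - star N.det * N.det) * H.det = 0 := by linear_combination h2
    rcases mul_eq_zero.1 h3 with h4 | h4
    · exact absurd (sub_eq_zero.1 h4).symm hN
    · exact h4
  -- Cayley–Hamilton with det H = 0. The linear equation for H thus passes to H², where both terms
  -- are positive and must vanish.
  have hsq : H * H = H.trace • H := by
    rw [det_fin_two] at hdet
    ext i j
    fin_cases i <;> fin_cases j <;>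
      simp [Matrix.mul_apply, Fin.sum_univ_two, trace_fin_two] <;>
      first | ring1 | linear_combination -hdet
  have hpos : (H * H).PosSemidef := by
    have := posSemidef_conjTranspose_mul_self H
    rwa [hH.eq] at this
  have hpos' : (Nᴴ * (H * H) * N).PosSemidef := hpos.conjTranspose_mul_mul_same N
  have hsum : H * H + Nᴴ * (H * H) * N = 0 := by
    rw [hsq, Matrix.mul_smul, Matrix.smul_mul, ← smul_add, h, smul_zero]
  have h0 : H * H = 0 := by
    have h1 : H * H = -(Nᴴ * (H * H) * N) := eq_neg_of_add_eq_zero_left hsum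
    refine le_antisymm ?_ hpos.nonneg
    rw [h1]
    exact neg_nonpos.2 hpos'.nonneg
  have : Hᴴ * H = 0 := by rw [hH.eq, h0]
  exact Matrix.conjTranspose_mul_self_eq_zero.1 this

/-! ### Choi matrices and complete positivity. -/

/-- The block at position `(k, l)` of the (reordered) Choi matrix: its `(i, j)` entry is the
`(k, l)` entry of the image of the matrix unit `E_ij`. -/
noncomputable def choiBlock (Φ : M2 →L[ℂ] M2) (k l : Fin 2) : M2 :=
  of fun i j => Φ (Matrix.single i j 1) k l

/-- The Choi matrix of `Φ`, arranged such that the output index is the block index. -/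
noncomputable def choiMatrix (Φ : M2 →L[ℂ] M2) : Matrix (Fin 2 ⊕ Fin 2) (Fin 2 ⊕ Fin 2) ℂ :=
  fromBlocks (choiBlock Φ 0 0) (choiBlock Φ 0 1) (choiBlock Φ 1 0) (choiBlock Φ 1 1)

/-- The linear map with prescribed Choi blocks. -/
noncomputable def ofChoi : (Fin 2 → Fin 2 → Fin 2 → Fin 2 → ℂ) →ₗ[ℂ] (M2 →L[ℂ] M2) where
  toFun B := LinearMap.toContinuousLinearMap
    { toFun := fun X => of fun k l => ∑ i, ∑ j, X i j * B k l i j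
      map_add' := fun X Y => by
        ext k l
        simp [add_mul, Finset.sum_add_distrib]
      map_smul' := fun c X => by
        ext k l
        simp [mul_assoc, mul_add] }
  map_add' B B' := by
    ext X k l
    simp [mul_add, Finset.sum_add_distrib]
  map_smul' c B := by
    ext X k l
    simp [mul_add, mul_left_comm]

theorem ofChoi_apply (B : Fin 2 → Fin 2 → Fin 2 → Fin 2 → ℂ) (X : M2) (k l : Fin 2) :
    ofChoi B X k l = ∑ i, ∑ j, X i j * B k l i j := rfl

theorem map_apply_eq_sum (Φ : M2 →L[ℂ] M2) (X : M2) (k l : Fin 2) :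
    Φ X k l = ∑ i, ∑ j, X i j * choiBlock Φ k l i j := by
  conv_lhs => rw [matrix_eq_sum_single X]
  simp only [map_sum, Matrix.sum_apply, choiBlock, of_apply]
  refine Finset.sum_congr rfl fun i _ => Finset.sum_congr rfl fun j _ => ?_
  have : Matrix.single i j (X i j) = X i j • Matrix.single i j (1 : ℂ) := by simp
  rw [this, map_smul, Matrix.smul_apply, smul_eq_mul]

theorem ofChoi_choiBlock (Φ : M2 →L[ℂ] M2) : ofChoi (fun k l i j => choiBlock Φ k l i j) = Φ := by
  ext X k l
  rw [ofChoi_apply, map_apply_eq_sum]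

theorem choiBlock_ofChoi (B : Fin 2 → Fin 2 → Fin 2 → Fin 2 → ℂ) (k l : Fin 2) :
    choiBlock (ofChoi B) k l = of (B k l) := by
  ext i j
  simp [choiBlock, ofChoi_apply, Matrix.single_apply, ite_and]

theorem ext_choiBlock {Φ Ψ : M2 →L[ℂ] M2} (h : ∀ k l, choiBlock Φ k l = choiBlock Ψ k l) :
    Φ = Ψ := by
  rw [← ofChoi_choiBlock Φ, ← ofChoi_choiBlock Ψ]
  simp only [h]

theorem choiBlock_add (Φ Ψ : M2 →L[ℂ] M2) (k l : Fin 2) :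
    choiBlock (Φ + Ψ) k l = choiBlock Φ k l + choiBlock Ψ k l := rfl

theorem choiBlock_smul (r : ℝ) (Φ : M2 →L[ℂ] M2) (k l : Fin 2) :
    choiBlock (r • Φ) k l = r • choiBlock Φ k l := rfl

theorem isTracePreserving_iff (Φ : M2 →L[ℂ] M2) :
    IsTracePreserving Φ ↔ choiBlock Φ 0 0 + choiBlock Φ 1 1 = 1 := by
  constructor
  · intro h
    ext i j
    have := h (Matrix.single i j 1)
    rw [trace_fin_two] at this
    rw [Matrix.add_apply]
    refine this.trans ?_
    fin_cases i <;> fin_cases j <;> simp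
  · intro h X
    rw [trace_fin_two, map_apply_eq_sum, map_apply_eq_sum]
    have h' : ∀ i j, choiBlock Φ 1 1 i j = (1 : M2) i j - choiBlock Φ 0 0 i j := fun i j => by
      rw [← h, Matrix.add_apply, add_sub_cancel_left]
    simp only [h', Fin.sum_univ_two, trace_fin_two]
    simp
    ring

theorem exists_eq_star_mul_self_of_nonneg {A : Type*} [CStarAlgebra A] [PartialOrder A]
    [StarOrderedRing A] {a : A} (ha : 0 ≤ a) : ∃ b : A, a = star b * b :=
  CStarAlgebra.nonneg_iff_eq_star_mul_self.1 ha

/-- Apply 2-positivity to the matrix of matrix units, which is F*F for an F with one nonzero row. A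
factorization of the image, with indices regrouped, exhibits the Choi matrix as a Gram matrix. -/
theorem choiMatrix_posSemidef {Φ : M2 →L[ℂ] M2} (h : IsCompletelyPositive Φ) :
    (choiMatrix Φ).PosSemidef := by
  obtain ⟨φ, hφ⟩ := h
  let E : CStarMatrix (Fin 2) (Fin 2) M2 := CStarMatrix.ofMatrix fun i j => Matrix.single i j 1
  let F : CStarMatrix (Fin 2) (Fin 2) M2 :=
    CStarMatrix.ofMatrix fun i j => if i = 0 then Matrix.single 0 j 1 else 0
  have hE : E = star F * F := by
    ext1 i j
    rw [CStarMatrix.mul_apply]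
    change Matrix.single i j 1 = ∑ p : Fin 2, star (if p = 0 then Matrix.single 0 i 1 else 0 : M2) *
      (if p = 0 then Matrix.single 0 j 1 else 0)
    simp [star_eq_conjTranspose]
  have hE0 : 0 ≤ E := hE ▸ star_mul_self_nonneg F
  have h1 := φ.map_cstarMatrix_nonneg' 2 E hE0
  obtain ⟨G, hG⟩ := exists_eq_star_mul_self_of_nonneg h1
  have hG' : ∀ i j k l, Φ (Matrix.single i j 1) k l
      = ∑ p, ∑ q, star (G p i q k) * G p j q l := by
    intro i j k l
    have h2 : Φ (Matrix.single i j 1) = (star G * G) i j := by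
      rw [← hG]
      exact (LinearMap.congr_fun hφ (Matrix.single i j 1)).symm
    rw [h2, CStarMatrix.mul_apply, Matrix.sum_apply]
    rfl
  let L : Matrix (Fin 2 × Fin 2) (Fin 2 ⊕ Fin 2) ℂ :=
    of fun pq => Sum.elim (fun i => G pq.1 i pq.2 0) (fun i => G pq.1 i pq.2 1)
  have hL : choiMatrix Φ = Lᴴ * L := by
    ext (i | i) (j | j) <;>
      simp [choiMatrix, choiBlock, Matrix.mul_apply, hG', L, Fintype.sum_prod_type]
  rw [hL]
  exact posSemidef_conjTranspose_mul_self L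

/-- The rows of a factor L of the Choi matrix L*L, reshaped, are Kraus operators: Φ X = ∑ K_m* X
K_m. Such a map sends N*N to a sum of squares at every matrix level. -/
theorem isCompletelyPositive_of_choiMatrix {Φ : M2 →L[ℂ] M2} (h : (choiMatrix Φ).PosSemidef) :
    IsCompletelyPositive Φ := by
  obtain ⟨L, hL⟩ := CStarAlgebra.nonneg_iff_eq_star_mul_self.1 h.nonneg
  let s : Fin 2 → Fin 2 → Fin 2 ⊕ Fin 2 := fun k i => if k = 0 then Sum.inl i else Sum.inr i
  have hblock : ∀ k l i j, choiBlock Φ k l i j = ∑ m, star (L m (s k i)) * L m (s l j) := by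
    intro k l i j
    have h1 : choiBlock Φ k l i j = choiMatrix Φ (s k i) (s l j) := by
      fin_cases k <;> fin_cases l <;> rfl
    rw [h1, hL, Matrix.mul_apply]
    rfl
  let K : Fin 2 ⊕ Fin 2 → M2 := fun m => of fun i k => L m (s k i)
  have hK : ∀ X, Φ X = ∑ m, star (K m) * X * K m := by
    intro X
    ext k l
    rw [map_apply_eq_sum, Matrix.sum_apply]
    simp only [hblock, Matrix.mul_apply, star_apply, K, of_apply, Finset.mul_sum, Finset.sum_mul]
    rw [Finset.sum_comm]
    conv_lhs => enter [2, j]; rw [Finset.sum_comm]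
    rw [Finset.sum_comm]
    refine Finset.sum_congr rfl fun m _ => Finset.sum_congr rfl fun j _ =>
      Finset.sum_congr rfl fun i _ => by ring
  refine ⟨⟨(Φ : M2 →ₗ[ℂ] M2), fun k M hM => ?_⟩, rfl⟩
  obtain ⟨N, rfl⟩ := exists_eq_star_mul_self_of_nonneg hM
  have h2 : (star N * N).map (Φ : M2 →ₗ[ℂ] M2)
      = ∑ m, star (CStarMatrix.ofMatrix fun i j => N i j * K m : CStarMatrix (Fin k) (Fin k) M2) *
        (CStarMatrix.ofMatrix fun i j => N i j * K m) := by
    ext1 i j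
    have h3 : (∑ m, star (CStarMatrix.ofMatrix fun i j => N i j * K m :
        CStarMatrix (Fin k) (Fin k) M2) * (CStarMatrix.ofMatrix fun i j => N i j * K m)) i j
        = ∑ m, (star (CStarMatrix.ofMatrix fun i j => N i j * K m :
        CStarMatrix (Fin k) (Fin k) M2) * (CStarMatrix.ofMatrix fun i j => N i j * K m)) i j :=
      Matrix.sum_apply i j _ _
    rw [h3, CStarMatrix.map_apply, ContinuousLinearMap.coe_coe, hK]
    refine Finset.sum_congr rfl fun m _ => ?_
    rw [CStarMatrix.mul_apply, CStarMatrix.mul_apply, Finset.mul_sum, Finset.sum_mul]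
    refine Finset.sum_congr rfl fun p _ => ?_
    change star (K m) * (star (N p i) * N p j) * K m = star (N p i * K m) * (N p j * K m)
    simp only [star_mul, mul_assoc]
  rw [h2]
  exact Finset.sum_nonneg fun m _ => star_mul_self_nonneg _

theorem mem_stochasticMaps_iff (Φ : M2 →L[ℂ] M2) :
    Φ ∈ stochasticMaps ↔
      (choiMatrix Φ).PosSemidef ∧ choiBlock Φ 0 0 + choiBlock Φ 1 1 = 1 :=
  and_congr ⟨choiMatrix_posSemidef, isCompletelyPositive_of_choiMatrix⟩ (isTracePreserving_iff Φ)

/-! ### Block parametrization and the Schur complement. -/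

/-- The trace-preserving map with first row of Choi blocks `A`, `C`. -/
noncomputable def ofBlocks (A C : M2) : M2 →L[ℂ] M2 :=
  ofChoi fun k l i j => (![![A, C], ![Cᴴ, 1 - A]] : Fin 2 → Fin 2 → M2) k l i j

theorem choiBlock_ofBlocks (A C : M2) (k l : Fin 2) :
    choiBlock (ofBlocks A C) k l = (![![A, C], ![Cᴴ, 1 - A]] : Fin 2 → Fin 2 → M2) k l :=
  choiBlock_ofChoi _ k l

theorem choiMatrix_ofBlocks (A C : M2) :
    choiMatrix (ofBlocks A C) = fromBlocks A C Cᴴ (1 - A) := by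
  simp [choiMatrix, choiBlock_ofBlocks]

theorem choiBlock_conjTranspose {Φ : M2 →L[ℂ] M2} (h : Φ ∈ stochasticMaps) :
    (choiBlock Φ 0 0).IsHermitian ∧ (choiBlock Φ 0 1)ᴴ = choiBlock Φ 1 0 := by
  have := ((mem_stochasticMaps_iff Φ).1 h).1.isHermitian
  rw [choiMatrix, isHermitian_fromBlocks_iff] at this
  exact ⟨this.1, this.2.1⟩

theorem eq_ofBlocks {Φ : M2 →L[ℂ] M2} (h : Φ ∈ stochasticMaps) :
    Φ = ofBlocks (choiBlock Φ 0 0) (choiBlock Φ 0 1) := by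
  refine ext_choiBlock fun k l => ?_
  rw [choiBlock_ofBlocks, (choiBlock_conjTranspose h).2,
    ← eq_sub_of_add_eq' ((mem_stochasticMaps_iff Φ).1 h).2]
  fin_cases k <;> fin_cases l <;> rfl

theorem ofBlocks_mem_stochasticMaps_iff {A : M2} (hA : A.PosDef) (C : M2) :
    ofBlocks A C ∈ stochasticMaps ↔ (1 - A - Cᴴ * A⁻¹ * C).PosSemidef := by
  have := hA.isUnit.invertible
  rw [mem_stochasticMaps_iff, choiMatrix_ofBlocks, hA.fromBlocks₁₁]
  simp [choiBlock_ofBlocks]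

/-! ### Extremality of maps with vanishing Schur complement. -/

theorem mul_eq_zero_of_conjTranspose_mul_mul_eq_zero {m n : Type*} [Fintype m] [Fintype n]
    [DecidableEq m] {B : Matrix m m ℂ} (hB : B.PosSemidef) {X : Matrix m n ℂ}
    (h : Xᴴ * B * X = 0) : B * X = 0 := by
  obtain ⟨L, rfl⟩ := CStarAlgebra.nonneg_iff_eq_star_mul_self.1 hB.nonneg
  have h1 : (L * X)ᴴ * (L * X) = 0 := by
    rw [conjTranspose_mul, ← h]
    simp only [star_eq_conjTranspose, Matrix.mul_assoc]
  rw [Matrix.mul_assoc, conjTranspose_mul_self_eq_zero.1 h1, Matrix.mul_zero]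

/-- Compressing by X gives a sum of two positive matrices equal to zero. Hence the summands of a
Choi matrix inherit its kernel. -/
theorem mul_eq_zero_of_smul_add_smul_mul_eq_zero {m n : Type*} [Fintype m] [Fintype n]
    [DecidableEq m] {B B' : Matrix m m ℂ} (hB : B.PosSemidef) (hB' : B'.PosSemidef)
    {a b : ℝ} (ha : 0 < a) (hb : 0 < b) {X : Matrix m n ℂ} (h : (a • B + b • B') * X = 0) :
    B * X = 0 := by
  refine mul_eq_zero_of_conjTranspose_mul_mul_eq_zero hB ?_
  have h1 : a • (Xᴴ * B * X) + b • (Xᴴ * B' * X) = 0 := by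
    have : Xᴴ * ((a • B + b • B') * X) = 0 := by rw [h, Matrix.mul_zero]
    rw [← this]
    simp [Matrix.add_mul, Matrix.mul_add, Matrix.mul_assoc]
  have h2 : 0 ≤ Xᴴ * B * X := (hB.conjTranspose_mul_mul_same X).nonneg
  have h3 : 0 ≤ Xᴴ * B' * X := (hB'.conjTranspose_mul_mul_same X).nonneg
  have h4 : a • (Xᴴ * B * X) = 0 :=
    ((add_eq_zero_iff_of_nonneg (smul_nonneg ha.le h2) (smul_nonneg hb.le h3)).1 h1).1
  exact (smul_eq_zero.1 h4).resolve_left ha.ne'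

/-- Here |det(A⁻¹C)|² = det(1 − A) / det A, and det(1 − A) = 1 − tr A + det A. -/
theorem star_det_mul_det_ne_one {A C : M2} (hA : A.PosDef) (htr : A.trace ≠ 1)
    (h : Cᴴ * A⁻¹ * C = 1 - A) : star (A⁻¹ * C).det * (A⁻¹ * C).det ≠ 1 := by
  intro h1
  have hd : A.det ≠ 0 := hA.det_pos.ne'
  have hs : star A.det = A.det := by rw [← det_conjTranspose, hA.isHermitian.eq]
  have h2 : star C.det * A.det⁻¹ * C.det = (1 - A).det := by
    rw [← h, det_mul, det_mul, det_conjTranspose, det_nonsing_inv, Ring.inverse_eq_inv']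
  have h3 : (1 - A).det = 1 - A.trace + A.det := by
    simp [det_fin_two, trace_fin_two]
    ring
  rw [det_mul, det_nonsing_inv, Ring.inverse_eq_inv', star_mul', star_inv₀, hs] at h1
  have h4 : (1 - A).det = A.det := by
    rw [← h2]
    calc star C.det * A.det⁻¹ * C.det
        = (A.det⁻¹ * star C.det * (A.det⁻¹ * C.det)) * A.det := by field_simp
      _ = A.det := by rw [h1, one_mul]
  apply htr
  linear_combination h3 - h4

/-- If the Choi matrix has rank two, its corner `A` is positive definite and `tr A ≠ 1`, then the
map is an extreme point. -/
theorem ofBlocks_mem_extremePoints {A C : M2} (hA : A.PosDef) (htr : A.trace ≠ 1)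
    (h : Cᴴ * A⁻¹ * C = 1 - A) : ofBlocks A C ∈ Set.extremePoints ℝ stochasticMaps := by
  refine ⟨(ofBlocks_mem_stochasticMaps_iff hA C).2 (by rw [h, sub_self]; exact .zero), ?_⟩
  rintro Φ hΦ Ψ hΨ ⟨a, b, ha, hb, -, hab⟩
  set N : M2 := A⁻¹ * C with hN
  have hAdet : IsUnit A.det := (isUnit_iff_isUnit_det A).1 hA.isUnit
  have hAN : A * N = C := by rw [hN, ← Matrix.mul_assoc, mul_nonsing_inv _ hAdet, Matrix.one_mul]
  have hCN : Cᴴ * N = 1 - A := by rw [hN, ← Matrix.mul_assoc, h]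
  have hdetN := star_det_mul_det_ne_one hA htr h
  rw [← hN] at hdetN
  clear_value N
  have hNAN : Nᴴ * A * N = 1 - A := by
    rw [← hCN, ← hAN, conjTranspose_mul, hA.isHermitian.eq]
  -- The columns of X span the kernel of the Choi matrix of `ofBlocks A C`.
  let X : Matrix (Fin 2 ⊕ Fin 2) (Fin 2) ℂ := fromRows (-N) 1
  have hX : (a • choiMatrix Φ + b • choiMatrix Ψ) * X = 0 := by
    have h1 : a • choiMatrix Φ + b • choiMatrix Ψ = choiMatrix (ofBlocks A C) := by
      rw [← hab]
      simp only [choiMatrix, fromBlocks_smul, fromBlocks_add]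
      rfl
    rw [h1, choiMatrix_ofBlocks, fromBlocks_mul_fromRows, Matrix.mul_neg, hAN, Matrix.mul_neg, hCN]
    ext (i | i) j <;> simp
  have hΦX := mul_eq_zero_of_smul_add_smul_mul_eq_zero ((mem_stochasticMaps_iff Φ).1 hΦ).1
    ((mem_stochasticMaps_iff Ψ).1 hΨ).1 ha hb hX
  have htp := ((mem_stochasticMaps_iff Φ).1 hΦ).2
  obtain ⟨hH, hC⟩ := choiBlock_conjTranspose hΦ
  rw [choiMatrix, fromBlocks_mul_fromRows] at hΦX
  have hC1 : choiBlock Φ 0 1 = choiBlock Φ 0 0 * N := by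
    have h1 : choiBlock Φ 0 0 * (-N) + choiBlock Φ 0 1 * 1 = 0 := by
      ext i j
      exact congr_fun (congr_fun hΦX (Sum.inl i)) j
    rw [Matrix.mul_neg, Matrix.mul_one] at h1
    exact eq_of_sub_eq_zero (by rw [← h1]; abel)
  have hD1 : choiBlock Φ 1 1 = choiBlock Φ 1 0 * N := by
    have h1 : choiBlock Φ 1 0 * (-N) + choiBlock Φ 1 1 * 1 = 0 := by
      ext i j
      exact congr_fun (congr_fun hΦX (Sum.inr i)) j
    rw [Matrix.mul_neg, Matrix.mul_one] at h1
    exact eq_of_sub_eq_zero (by rw [← h1]; abel)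
  -- The kernel condition leaves Φ with blocks A', A'N, N*A', N*A'N. Trace preservation for Φ and
  -- for `ofBlocks A C` then gives H + N*HN = 0 with H = A' − A.
  have hHz : choiBlock Φ 0 0 - A = 0 := by
    refine eq_zero_of_add_conjTranspose_mul_mul_eq_zero _ N (hH.sub hA.isHermitian) ?_ hdetN
    rw [hD1, ← hC, hC1, conjTranspose_mul, hH.eq] at htp
    rw [Matrix.mul_sub, Matrix.sub_mul, hNAN, eq_sub_of_add_eq' htp]
    abel
  have hAA : choiBlock Φ 0 0 = A := sub_eq_zero.1 hHz
  rw [eq_ofBlocks hΦ, hC1, hAA, hAN]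

/-! ### Midpoints in the generic case. -/

/-- A stochastic map with generic Choi blocks is a midpoint of two extreme points. -/
theorem ofBlocks_midpoint {A C : M2} (hA : A.PosDef) (hA' : (1 - A).PosDef) (htr : A.trace ≠ 1)
    (hC : C.det ≠ 0) (h : ofBlocks A C ∈ stochasticMaps) :
    ∃ Φ ∈ Set.extremePoints ℝ stochasticMaps, ∃ Ψ ∈ Set.extremePoints ℝ stochasticMaps,
      ofBlocks A C = (1 / 2 : ℝ) • Φ + (1 / 2 : ℝ) • Ψ := by
  obtain ⟨S, hS⟩ := CStarAlgebra.nonneg_iff_eq_star_mul_self.1 hA.posSemidef.nonneg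
  obtain ⟨T, hT⟩ := CStarAlgebra.nonneg_iff_eq_star_mul_self.1 hA'.posSemidef.nonneg
  rw [star_eq_conjTranspose] at hS hT
  have hSu : IsUnit S := isUnit_of_mul_isUnit_right (hS ▸ hA.isUnit)
  have hTu : IsUnit T := isUnit_of_mul_isUnit_right (hT ▸ hA'.isUnit)
  have hSd : IsUnit S.det := (isUnit_iff_isUnit_det S).1 hSu
  have hTd : IsUnit T.det := (isUnit_iff_isUnit_det T).1 hTu
  have hSd' : IsUnit Sᴴ.det := by rw [det_conjTranspose]; exact hSd.star
  have hTd' : IsUnit Tᴴ.det := by rw [det_conjTranspose]; exact hTd.star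
  have hAi : A⁻¹ = S⁻¹ * (S⁻¹)ᴴ := by rw [hS, Matrix.mul_inv_rev, conjTranspose_nonsing_inv]
  set R : M2 := (S⁻¹)ᴴ * C * T⁻¹ with hR
  have hRC : Sᴴ * R * T = C := by
    rw [hR, conjTranspose_nonsing_inv]
    simp only [Matrix.mul_assoc]
    rw [nonsing_inv_mul _ hTd, mul_one, mul_nonsing_inv_cancel_left _ _ hSd']
  have hRu : IsUnit R := by
    rw [isUnit_iff_isUnit_det, isUnit_iff_ne_zero]
    intro h0
    apply hC
    rw [← hRC, det_mul, det_mul, h0]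
    ring
  have hRR : (1 - Rᴴ * R).PosSemidef := by
    have h1 := ((ofBlocks_mem_stochasticMaps_iff hA C).1 h).conjTranspose_mul_mul_same T⁻¹
    have h2 : (T⁻¹)ᴴ * (1 - A - Cᴴ * A⁻¹ * C) * T⁻¹ = 1 - Rᴴ * R := by
      have h3 : (T⁻¹)ᴴ * (1 - A) * T⁻¹ = 1 := by
        rw [hT, Matrix.mul_assoc, Matrix.mul_assoc, mul_nonsing_inv _ hTd, Matrix.mul_one,
          conjTranspose_nonsing_inv, nonsing_inv_mul _ hTd']
      have h4 : (T⁻¹)ᴴ * (Cᴴ * A⁻¹ * C) * T⁻¹ = Rᴴ * R := by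
        rw [hR, hAi, conjTranspose_mul, conjTranspose_mul, conjTranspose_conjTranspose]
        simp only [Matrix.mul_assoc]
      rw [Matrix.mul_sub, Matrix.sub_mul, h3, h4]
    rwa [h2] at h1
  obtain ⟨U, V, hU, hV, hUV⟩ := exists_unitary_midpoint R hRu hRR
  -- Putting a unitary in place of R makes the Schur complement vanish.
  have key : ∀ W : M2, Wᴴ * W = 1 →
      ofBlocks A (Sᴴ * W * T) ∈ Set.extremePoints ℝ stochasticMaps := by
    intro W hW
    refine ofBlocks_mem_extremePoints hA htr ?_
    have h1 : S * A⁻¹ * Sᴴ = 1 := by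
      rw [hAi, ← Matrix.mul_assoc, mul_nonsing_inv _ hSd, Matrix.one_mul,
        conjTranspose_nonsing_inv, nonsing_inv_mul _ hSd']
    calc (Sᴴ * W * T)ᴴ * A⁻¹ * (Sᴴ * W * T) = Tᴴ * (Wᴴ * (S * A⁻¹ * Sᴴ) * W) * T := by
          simp only [conjTranspose_mul, conjTranspose_conjTranspose, Matrix.mul_assoc]
      _ = 1 - A := by rw [h1, Matrix.mul_one, hW, Matrix.mul_one, hT]
  refine ⟨_, key U hU, _, key V hV, ext_choiBlock fun k l => ?_⟩
  have hCm : C = (1 / 2 : ℝ) • (Sᴴ * U * T) + (1 / 2 : ℝ) • (Sᴴ * V * T) := by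
    rw [← hRC, hUV]
    simp [Matrix.mul_add, Matrix.add_mul]
  have hhalf : ∀ Y : M2, Y = (1 / 2 : ℝ) • Y + (1 / 2 : ℝ) • Y := fun Y => by
    rw [← add_smul]; norm_num
  rw [choiBlock_add, choiBlock_smul, choiBlock_smul, choiBlock_ofBlocks, choiBlock_ofBlocks,
    choiBlock_ofBlocks]
  fin_cases k <;> fin_cases l
  · exact hhalf A
  · exact hCm
  · change Cᴴ = (1 / 2 : ℝ) • (Sᴴ * U * T)ᴴ + (1 / 2 : ℝ) • (Sᴴ * V * T)ᴴ
    conv_lhs => rw [hCm]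
    rw [conjTranspose_add, conjTranspose_smul, conjTranspose_smul, star_trivial]
  · exact hhalf (1 - A)

/-! ### Compactness and closedness. -/

/-- The entries are inner products of the columns of a factor L; trace preservation bounds those
columns by 1 in norm. This supplies the boundedness needed for compactness. -/
theorem norm_choiBlock_le {Φ : M2 →L[ℂ] M2} (h : Φ ∈ stochasticMaps) (k l i j : Fin 2) :
    ‖choiBlock Φ k l i j‖ ≤ 1 := by
  rw [mem_stochasticMaps_iff] at h
  obtain ⟨L, hL⟩ := CStarAlgebra.nonneg_iff_eq_star_mul_self.1 h.1.nonneg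
  let s : Fin 2 → Fin 2 → Fin 2 ⊕ Fin 2 := fun k i => if k = 0 then Sum.inl i else Sum.inr i
  have hblock : ∀ k l i j, choiBlock Φ k l i j = ∑ m, star (L m (s k i)) * L m (s l j) := by
    intro k l i j
    have h1 : choiBlock Φ k l i j = choiMatrix Φ (s k i) (s l j) := by
      fin_cases k <;> fin_cases l <;> rfl
    rw [h1, hL, Matrix.mul_apply]
    rfl
  have hdiag : ∀ i, ∑ m, ‖L m (s 0 i)‖ ^ 2 + ∑ m, ‖L m (s 1 i)‖ ^ 2 = 1 := by
    intro i
    have h1 : choiBlock Φ 0 0 i i + choiBlock Φ 1 1 i i = 1 := by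
      rw [← Matrix.add_apply, h.2, Matrix.one_apply_eq]
    rw [hblock, hblock] at h1
    simp only [Complex.star_def, Complex.conj_mul'] at h1
    exact_mod_cast h1
  have hle : ∀ k i, ∑ m, ‖L m (s k i)‖ ^ 2 ≤ 1 := by
    intro k i
    have h0 : ∀ k, 0 ≤ ∑ m, ‖L m (s k i)‖ ^ 2 := fun k =>
      Finset.sum_nonneg fun m _ => sq_nonneg _
    have := hdiag i
    fin_cases k
    · exact this ▸ le_add_of_nonneg_right (h0 1)
    · exact this ▸ le_add_of_nonneg_left (h0 0)
  rw [hblock]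
  calc ‖∑ m, star (L m (s k i)) * L m (s l j)‖
      ≤ ∑ m, ‖L m (s k i)‖ * ‖L m (s l j)‖ :=
        (norm_sum_le _ _).trans_eq (by simp)
    _ ≤ ∑ m, (‖L m (s k i)‖ ^ 2 + ‖L m (s l j)‖ ^ 2) / 2 :=
        Finset.sum_le_sum fun m _ => by
          linarith [two_mul_le_add_sq ‖L m (s k i)‖ ‖L m (s l j)‖]
    _ = (∑ m, ‖L m (s k i)‖ ^ 2 + ∑ m, ‖L m (s l j)‖ ^ 2) / 2 := by
        rw [← Finset.sum_div, Finset.sum_add_distrib]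
    _ ≤ 1 := by linarith [hle k i, hle l j]

theorem isCompact_generalizedExtremePoints : IsCompact generalizedExtremePoints := by
  have hc : Continuous ofChoi := LinearMap.continuous_of_finiteDimensional _
  have hK := (isCompact_closedBall (0 : Fin 2 → Fin 2 → Fin 2 → Fin 2 → ℂ) 1).image hc
  refine hK.closure_of_subset fun Φ hΦ => ⟨_, ?_, ofChoi_choiBlock Φ⟩
  rw [mem_closedBall_zero_iff]
  have h := norm_choiBlock_le hΦ.1
  simp only [pi_norm_le_iff_of_nonneg zero_le_one]
  exact h

/-- The set of midpoints of two generalized extreme points is closed. -/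
theorem isClosed_midpoints : IsClosed {Φ : M2 →L[ℂ] M2 | ∃ Φ₁ ∈ generalizedExtremePoints,
    ∃ Φ₂ ∈ generalizedExtremePoints, Φ = (1 / 2 : ℝ) • Φ₁ + (1 / 2 : ℝ) • Φ₂} := by
  have hc : Continuous fun p : (M2 →L[ℂ] M2) × (M2 →L[ℂ] M2) =>
      (1 / 2 : ℝ) • p.1 + (1 / 2 : ℝ) • p.2 := by fun_prop
  have hK := (isCompact_generalizedExtremePoints.prod
    isCompact_generalizedExtremePoints).image hc
  convert hK.isClosed using 1
  ext Φ
  constructor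
  · rintro ⟨Φ₁, h₁, Φ₂, h₂, rfl⟩
    exact ⟨(Φ₁, Φ₂), ⟨h₁, h₂⟩, rfl⟩
  · rintro ⟨⟨Φ₁, Φ₂⟩, ⟨h₁, h₂⟩, rfl⟩
    exact ⟨Φ₁, h₁, Φ₂, h₂, rfl⟩

/-! ### Perturbation to the generic case. -/

theorem convex_stochasticMaps : Convex ℝ stochasticMaps := by
  intro Φ hΦ Ψ hΨ a b ha hb hab
  rw [mem_stochasticMaps_iff] at *
  constructor
  · have h1 : choiMatrix (a • Φ + b • Ψ) = a • choiMatrix Φ + b • choiMatrix Ψ := by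
      simp only [choiMatrix, fromBlocks_smul, fromBlocks_add]
      rfl
    rw [h1]
    exact (hΦ.1.smul ha).add (hΨ.1.smul hb)
  · simp only [choiBlock_add, choiBlock_smul]
    rw [add_add_add_comm, ← smul_add, ← smul_add, hΦ.2, hΨ.2, ← add_smul, hab, one_smul]

/-- A segment of matrices ending at an invertible one consists of invertible matrices near its
start, except possibly for the start itself. -/
theorem eventually_det_ne_zero (C C₀ : M2) (h : C₀.det ≠ 0) :
    ∀ᶠ t : ℝ in nhdsWithin 0 {0}ᶜ, ((1 - t) • C + t • C₀).det ≠ 0 := by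
  by_contra hcon
  have hf : ∃ᶠ t : ℝ in nhdsWithin 0 {0}ᶜ, ((1 - t) • C + t • C₀).det = 0 := by
    simpa [Filter.not_eventually] using hcon
  -- The determinant is analytic in t; zeros accumulating at 0 would force it to vanish at t = 1,
  -- where it is det C₀.
  have han : AnalyticOnNhd ℝ (fun t : ℝ => ((1 - t) • C + t • C₀).det) Set.univ := by
    intro t _
    simp only [det_fin_two, Matrix.add_apply, Matrix.smul_apply]
    fun_prop
  have := han.eqOn_zero_of_preconnected_of_frequently_eq_zero isPreconnected_univ
    (Set.mem_univ 0) hf (Set.mem_univ 1)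
  apply h
  simpa using this

/-- There are stochastic maps whose blocks are scalar, with corner of trace below or above one. -/
theorem ofBlocks_smul_one_mem {a : ℝ} (ha : a = 1 / 3 ∨ a = 2 / 3) :
    ofBlocks (a • 1) ((1 / 3 : ℝ) • 1) ∈ stochasticMaps := by
  have ha0 : 0 < a := by rcases ha with rfl | rfl <;> norm_num
  have hA : (a • (1 : M2)).PosDef := PosDef.one.smul ha0
  rw [ofBlocks_mem_stochasticMaps_iff hA]
  have hinv : (a • (1 : M2))⁻¹ = a⁻¹ • 1 := by
    refine inv_eq_right_inv ?_
    rw [smul_mul_smul_comm, mul_inv_cancel₀ ha0.ne', one_mul, one_smul]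
  have h1 : 1 - a • (1 : M2) - ((1 / 3 : ℝ) • (1 : M2))ᴴ * (a • (1 : M2))⁻¹ * ((1 / 3 : ℝ) • 1)
      = (1 - a - 1 / 3 * a⁻¹ * (1 / 3)) • (1 : M2) := by
    rw [hinv, conjTranspose_smul, conjTranspose_one, star_trivial, smul_mul_smul_comm,
      smul_mul_smul_comm, sub_smul, sub_smul, one_smul, mul_one, mul_one]
  rw [h1]
  refine PosSemidef.one.smul ?_
  -- The coefficient 1 − a − 1/(9a) equals 1/3 for a = 1/3 and 1/6 for a = 2/3.
  rcases ha with rfl | rfl <;> norm_num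

theorem mainTheorem7 (Φ : M2 →L[ℂ] M2) (hΦ : Φ ∈ stochasticMaps) :
    ∃ Φ₁ ∈ generalizedExtremePoints, ∃ Φ₂ ∈ generalizedExtremePoints,
      Φ = (1 / 2 : ℝ) • Φ₁ + (1 / 2 : ℝ) • Φ₂ := by
  have hpsd := ((mem_stochasticMaps_iff Φ).1 hΦ).1
  have htp := ((mem_stochasticMaps_iff Φ).1 hΦ).2
  set A : M2 := choiBlock Φ 0 0 with hAdef
  have hA : A.PosSemidef := hpsd.submatrix Sum.inl
  have hA' : (1 - A).PosSemidef := by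
    rw [← htp, add_sub_cancel_left]
    exact hpsd.submatrix Sum.inr
  have htrim : A.trace = (A.trace.re : ℂ) := by
    have := hA.trace_nonneg
    exact (Complex.eq_re_of_ofReal_le (r := 0) (by simpa using this))
  -- The trace 2a of the corner of the perturbing map is chosen strictly on the side of 1 where tr A
  -- lies, so the mixed trace avoids 1 for all 0 < t < 1, even if tr A = 1.
  obtain ⟨a, ha, hat⟩ : ∃ a : ℝ, (a = 1 / 3 ∨ a = 2 / 3) ∧
      ∀ t : ℝ, 0 < t → t < 1 → (1 - t) * A.trace.re + t * (2 * a) ≠ 1 := by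
    rcases le_total A.trace.re 1 with h | h
    · exact ⟨1 / 3, Or.inl rfl, fun t h0 h1 => by nlinarith⟩
    · exact ⟨2 / 3, Or.inr rfl, fun t h0 h1 => by nlinarith⟩
  have ha0 : 0 < a := by rcases ha with rfl | rfl <;> norm_num
  have ha1 : 0 < 1 - a := by rcases ha with rfl | rfl <;> norm_num
  set Ψ := ofBlocks (a • 1) ((1 / 3 : ℝ) • 1) with hΨdef
  have hΨ : Ψ ∈ stochasticMaps := ofBlocks_smul_one_mem ha
  have hlim : Filter.Tendsto (fun t : ℝ => (1 - t) • Φ + t • Ψ) (nhdsWithin 0 (Set.Ioi 0))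
      (nhds Φ) := by
    have hc : Continuous fun t : ℝ => (1 - t) • Φ + t • Ψ := by fun_prop
    have h0 : (1 - 0 : ℝ) • Φ + (0 : ℝ) • Ψ = Φ :=
      ext_choiBlock fun k l => by simp [choiBlock_add, choiBlock_smul]
    have h1 := hc.tendsto 0
    rw [h0] at h1
    exact h1.mono_left nhdsWithin_le_nhds
  refine isClosed_midpoints.mem_of_tendsto hlim ?_
  have hdet : ∀ᶠ t : ℝ in nhdsWithin 0 (Set.Ioi 0),
      ((1 - t) • choiBlock Φ 0 1 + t • ((1 / 3 : ℝ) • (1 : M2))).det ≠ 0 :=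
    (eventually_det_ne_zero _ _ (by simp)).filter_mono
      (nhdsWithin_mono _ fun t ht => ne_of_gt ht)
  have hlt : ∀ᶠ t : ℝ in nhdsWithin 0 (Set.Ioi 0), t ∈ Set.Ioo (0 : ℝ) 1 :=
    Ioo_mem_nhdsGT one_pos
  filter_upwards [hdet, hlt] with t hdt ⟨ht0, ht1⟩
  have hmem : (1 - t) • Φ + t • Ψ ∈ stochasticMaps :=
    convex_stochasticMaps hΦ hΨ (sub_nonneg.2 ht1.le) ht0.le (sub_add_cancel 1 t)
  have hb0 : choiBlock ((1 - t) • Φ + t • Ψ) 0 0 = (1 - t) • A + t • a • 1 := by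
    rw [choiBlock_add, choiBlock_smul, choiBlock_smul, hΨdef, choiBlock_ofBlocks]
    rfl
  have hb1 : choiBlock ((1 - t) • Φ + t • Ψ) 0 1
      = (1 - t) • choiBlock Φ 0 1 + t • (1 / 3 : ℝ) • 1 := by
    rw [choiBlock_add, choiBlock_smul, choiBlock_smul, hΨdef, choiBlock_ofBlocks]
    rfl
  have heq := eq_ofBlocks hmem
  rw [hb0, hb1] at heq
  have hpd : ((1 - t) • A + t • a • (1 : M2)).PosDef :=
    PosDef.posSemidef_add (hA.smul (sub_nonneg.2 ht1.le)) ((PosDef.one.smul ha0).smul ht0)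
  have hpd' : (1 - ((1 - t) • A + t • a • (1 : M2))).PosDef := by
    have h1 : 1 - ((1 - t) • A + t • a • (1 : M2)) = (1 - t) • (1 - A) + t • (1 - a) • (1 : M2) := by
      module
    rw [h1]
    exact PosDef.posSemidef_add (hA'.smul (sub_nonneg.2 ht1.le)) ((PosDef.one.smul ha1).smul ht0)
  have htr : ((1 - t) • A + t • a • (1 : M2)).trace ≠ 1 := by
    rw [trace_add, trace_smul, trace_smul, trace_smul, htrim, trace_one]
    intro h1
    apply hat t ht0 ht1
    simp only [Complex.real_smul, Fintype.card_fin] at h1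
    have h2 : ((1 - t) * A.trace.re + t * (2 * a) : ℝ) = (1 : ℂ) := by
      rw [← h1]
      push_cast
      ring
    exact_mod_cast h2
  rw [heq] at hmem ⊢
  obtain ⟨Φ₁, h₁, Φ₂, h₂, h⟩ := ofBlocks_midpoint hpd hpd' htr hdt hmem
  exact ⟨Φ₁, subset_closure h₁, Φ₂, subset_closure h₂, h⟩
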